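/- Let $d\ge 0$ and let $E\subseteq\mathbb R^d$ be a nonempty compact set. Let $C(E)$ be the Banach space of continuous functions on $E$ (real-valued or complex-valued) with the supremum norm and, for $\gamma\in(0,1]$, let $C^{0,\gamma}(E)$ be the space of $\gamma$-Hölder continuous functions on $E$ with the norm $\|f\|_\infty+\sup_{x\ne y}\frac{|f(x)-f(y)|}{|x-y|^\gamma}$. Let $(\cdot,\cdot)_{\theta,\infty}$ denote the real interpolation functor, that is, the space of all $f\in C(E)$ with $\sup_{t>0}t^{-\theta}K(t,f)<\infty$, normed by this supremum, where $K(t,f)=\inf\{\|a\|_{C(E)}+t\|b\|_{C^{0,1}(E)}: f=a+b\}$, and let $[\cdot,\cdot]_\theta$ denote Calderón's complex interpolation functor (for real-valued functions, the complex interpolation space consists of the real-valued elements of the interpolation space of the complexified couple, which is formed by the corresponding spaces of complex-valued functions). Then, for every $\theta\in(0,1)$, \[ \bigl(C(E),C^{0,1}(E)\bigr)_{\theta,\infty}=C^{0,\theta}(E) \] with equivalent norms, and for all $\theta\in(0,1)$ and $\vartheta\in(\theta,1)$ there are continuous embeddings \[ C^{0,\vartheta}(E)\hookrightarrow\bigl[C(E),C^{0,1}(E)\bigr]_\theta\hookrightarrow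 C^{0,\theta}(E). \] -/

import Mathlib

open scoped NNReal ENNReal

noncomputable section

/-! ### Hölder spaces on a compact metric space -/

section HolderSpaces

variable (X : Type*) [MetricSpace X] [CompactSpace X] (𝕜 : Type*) [RCLike 𝕜] (γ : ℝ≥0)

/-- The Hölder continuous functions of exponent `γ`, as a linear subspace of `C(X, 𝕜)`. -/
def holderSubmodule : Submodule 𝕜 C(X, 𝕜) where
  carrier := {f | MemHolder γ (f : X → 𝕜)}
  add_mem' := fun hf hg => MemHolder.add hf hg
  zero_mem' := memHolder_zero
  smul_mem' := fun _ _ hf => MemHolder.smul hf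

/-- The space `C^{0,γ}(X)` of `𝕜`-valued Hölder continuous functions of exponent `γ`.  This is a
type synonym of the subspace `holderSubmodule X 𝕜 γ`; it carries the Hölder norm, not the
supremum norm. -/
def HolderSpace : Type _ := ↥(holderSubmodule X 𝕜 γ)

instance : AddCommGroup (HolderSpace X 𝕜 γ) :=
  inferInstanceAs (AddCommGroup ↥(holderSubmodule X 𝕜 γ))

instance : Module 𝕜 (HolderSpace X 𝕜 γ) :=
  inferInstanceAs (Module 𝕜 ↥(holderSubmodule X 𝕜 γ))

/-- The inclusion `C^{0,γ}(X) → C(X)` as a linear map. -/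
def holderInclₗ : HolderSpace X 𝕜 γ →ₗ[𝕜] C(X, 𝕜) := (holderSubmodule X 𝕜 γ).subtype

variable {X 𝕜 γ}

theorem holderInclₗ_injective : Function.Injective (holderInclₗ X 𝕜 γ) := Subtype.val_injective

theorem memHolder_holderInclₗ (f : HolderSpace X 𝕜 γ) :
    MemHolder γ (holderInclₗ X 𝕜 γ f : X → 𝕜) := f.2

variable (X 𝕜 γ)

/-- The Hölder norm `‖f‖_∞ + [f]_γ`, where `[f]_γ` is the least Hölder constant of `f`. -/
instance : Norm (HolderSpace X 𝕜 γ) where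
  norm f := ‖holderInclₗ X 𝕜 γ f‖ + (nnHolderNorm γ (holderInclₗ X 𝕜 γ f : X → 𝕜) : ℝ)

variable {X 𝕜 γ}

theorem HolderSpace.norm_def (f : HolderSpace X 𝕜 γ) :
    ‖f‖ = ‖holderInclₗ X 𝕜 γ f‖ + (nnHolderNorm γ (holderInclₗ X 𝕜 γ f : X → 𝕜) : ℝ) := rfl

theorem HolderSpace.core : NormedSpace.Core 𝕜 (HolderSpace X 𝕜 γ) where
  norm_nonneg f := by rw [HolderSpace.norm_def]; positivity
  norm_smul c f := by
    rw [HolderSpace.norm_def, HolderSpace.norm_def, map_smul, norm_smul, ContinuousMap.coe_smul,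
      (memHolder_holderInclₗ f).nnHolderNorm_smul, NNReal.coe_mul, coe_nnnorm, mul_add]
  norm_triangle f g := by
    have h : (nnHolderNorm γ (holderInclₗ X 𝕜 γ f + holderInclₗ X 𝕜 γ g : X → 𝕜) : ℝ) ≤
        nnHolderNorm γ (holderInclₗ X 𝕜 γ f : X → 𝕜) +
          nnHolderNorm γ (holderInclₗ X 𝕜 γ g : X → 𝕜) := by
      exact_mod_cast (memHolder_holderInclₗ f).nnHolderNorm_add_le (memHolder_holderInclₗ g)
    rw [HolderSpace.norm_def, HolderSpace.norm_def, HolderSpace.norm_def, map_add,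
      ContinuousMap.coe_add]
    linarith [norm_add_le (holderInclₗ X 𝕜 γ f) (holderInclₗ X 𝕜 γ g)]
  norm_eq_zero_iff f := by
    constructor
    · intro h
      rw [HolderSpace.norm_def] at h
      have h0 : ‖holderInclₗ X 𝕜 γ f‖ = 0 :=
        le_antisymm (by linarith [(nnHolderNorm γ (holderInclₗ X 𝕜 γ f : X → 𝕜)).coe_nonneg])
          (norm_nonneg _)
      exact holderInclₗ_injective (by rw [norm_eq_zero.mp h0, map_zero])
    · rintro rfl
      simp [HolderSpace.norm_def]

instance : NormedAddCommGroup (HolderSpace X 𝕜 γ) :=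
  NormedAddCommGroup.ofCore HolderSpace.core

instance : NormedSpace 𝕜 (HolderSpace X 𝕜 γ) := NormedSpace.ofCore HolderSpace.core

variable (X 𝕜 γ)

/-- The continuous injection `C^{0,γ}(X) ↪ C(X)`. -/
def holderIncl : HolderSpace X 𝕜 γ →L[𝕜] C(X, 𝕜) :=
  (holderInclₗ X 𝕜 γ).mkContinuous 1 fun f => by
    have h := HolderSpace.norm_def f
    linarith [(nnHolderNorm γ (holderInclₗ X 𝕜 γ f : X → 𝕜)).coe_nonneg]

theorem holderIncl_injective : Function.Injective (holderIncl X 𝕜 γ) := holderInclₗ_injective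

/-- A real-valued continuous function regarded as a complex-valued one. This is the canonical
inclusion of `C(X, ℝ)` into its complexification `C(X, ℂ)`. -/
def complexify (f : C(X, ℝ)) : C(X, ℂ) where
  toFun x := (f x : ℂ)
  continuous_toFun := Complex.continuous_ofReal.comp f.continuous

end HolderSpaces

/-! ### Normed spaces inside an ambient space

A normed space continuously included in `V` is described by its extended norm `N : V → ℝ≥0∞`:
the space is `{x | N x < ∞}`, normed by `N`. -/

section Subspaces

/-- The extended norm on `V` of the normed space `Y`, included in `V` by the injection `j`:
the norm of `y` at `j y`, and `∞` off the range of `j`. -/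
def inclENorm {𝕜 V Y : Type*} [RCLike 𝕜] [NormedAddCommGroup V] [NormedSpace 𝕜 V]
    [NormedAddCommGroup Y] [NormedSpace 𝕜 Y] (j : Y →L[𝕜] V) (x : V) : ℝ≥0∞ :=
  ⨅ (y : Y) (_ : j y = x), ‖y‖ₑ

/-- Continuous embedding: every element of the first space lies in the second, and the inclusion
is bounded. -/
def ContEmbeds {V : Type*} (N M : V → ℝ≥0∞) : Prop :=
  ∃ C : ℝ≥0, ∀ x, N x < ∞ → M x ≤ C * N x

/-- Equality of normed spaces up to equivalent norms: the same elements, and each norm is bounded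
by a multiple of the other. -/
def EqualSpaces {V : Type*} (N M : V → ℝ≥0∞) : Prop :=
  (∀ x, N x < ∞ ↔ M x < ∞) ∧ ContEmbeds N M ∧ ContEmbeds M N

end Subspaces

/-! ### Interpolation functors

The couple `(X, Y)` is given by a continuous injection `j : Y → X`, so that the sum space `X + Y`
is `X` up to an equivalent norm. -/

section RealMethod

variable {𝕜 X Y : Type*} [RCLike 𝕜] [NormedAddCommGroup X] [NormedSpace 𝕜 X]
  [NormedAddCommGroup Y] [NormedSpace 𝕜 Y]

/-- Peetre's K-functional `K(t, x) = inf {‖a‖_X + t ‖b‖_Y : x = a + b, a ∈ X, b ∈ Y}`. -/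
def kFunctional (j : Y →L[𝕜] X) (t : ℝ) (x : X) : ℝ :=
  ⨅ b : Y, (‖x - j b‖ + t * ‖b‖)

/-- The (extended) norm of the real interpolation space `(X, Y)_{θ,∞}`, namely
`sup_{t > 0} t^{-θ} K(t, x)`. -/
def realInterpENorm (j : Y →L[𝕜] X) (θ : ℝ) (x : X) : ℝ≥0∞ :=
  ⨆ (t : ℝ) (_ : 0 < t), ENNReal.ofReal (t ^ (-θ) * kFunctional j t x)

end RealMethod

section ComplexMethod

open Complex.HadamardThreeLines Filter Topology

variable {X Y : Type*} [NormedAddCommGroup X] [NormedSpace ℂ X]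
  [NormedAddCommGroup Y] [NormedSpace ℂ Y]

/-- Calderón's space of admissible functions for the complex method: functions with values in
`X + Y = X`, bounded and continuous on the closed strip `0 ≤ re z ≤ 1`, holomorphic in its
interior, such that `s ↦ F (i s)` and `s ↦ F (1 + i s)` are continuous functions from the real line
to `X` and to `Y`, respectively, vanishing at infinity. (Only the values of `toFun` on the closed
strip matter; continuity of `s ↦ F (i s)` into `X` is part of `continuousOn`.) -/
structure CalderonFun (j : Y →L[ℂ] X) where
  /-- the function on the strip -/
  toFun : ℂ → X
  /-- its boundary values on `re z = 1`, as elements of `Y` -/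
  bdry : ℝ → Y
  continuousOn : ContinuousOn toFun (verticalClosedStrip 0 1)
  differentiableOn : DifferentiableOn ℂ toFun (verticalStrip 0 1)
  bounded : ∃ C : ℝ, ∀ z ∈ verticalClosedStrip 0 1, ‖toFun z‖ ≤ C
  bdry_eq : ∀ s : ℝ, toFun (1 + s * Complex.I) = j (bdry s)
  continuous_bdry : Continuous bdry
  tendsto_left : Tendsto (fun s : ℝ => toFun (s * Complex.I)) (cocompact ℝ) (𝓝 0)
  tendsto_right : Tendsto bdry (cocompact ℝ) (𝓝 0)

/-- `‖F‖ = max (sup_s ‖F(is)‖_X) (sup_s ‖F(1+is)‖_Y)`. -/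
def CalderonFun.eNorm {j : Y →L[ℂ] X} (F : CalderonFun j) : ℝ≥0∞ :=
  max (⨆ s : ℝ, ‖F.toFun (s * Complex.I)‖ₑ) (⨆ s : ℝ, ‖F.bdry s‖ₑ)

/-- The (extended) norm of the complex interpolation space `[X, Y]_θ`: the infimum of `‖F‖` over
the admissible `F` with `F θ = x`; it is `∞` if there is no such `F`. -/
def complexInterpENorm (j : Y →L[ℂ] X) (θ : ℝ) (x : X) : ℝ≥0∞ :=
  ⨅ (F : CalderonFun j) (_ : F.toFun (θ : ℂ) = x), F.eNorm

end ComplexMethod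

/-- The (extended) norm of `[C(X), C^{0,1}(X)]_θ` for spaces of complex-valued functions. -/
def complexInterpHolderC (X : Type*) [MetricSpace X] [CompactSpace X] (θ : ℝ) :
    C(X, ℂ) → ℝ≥0∞ :=
  complexInterpENorm (holderIncl X ℂ 1) θ

/-- The (extended) norm of `[C(X), C^{0,1}(X)]_θ` for spaces of real-valued functions: the complex
method is applied to the complexified couple, which consists of the spaces of complex-valued
functions, and the interpolation space is the real part of the result. -/
def complexInterpHolderR (X : Type*) [MetricSpace X] [CompactSpace X] (θ : ℝ)
    (f : C(X, ℝ)) : ℝ≥0∞ :=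
  complexInterpHolderC X θ (complexify X f)

end

/-! Everything rests on trading regularity for accuracy at scale `t`. A γ-Hölder function is within
a multiple of `t^γ` of a function with Lipschitz constant of order `t^(γ-1)`, namely its
inf-convolution (`HolderSpace.exists_lipschitz_approx`). This gives `K(t,f) ≤ 7 t^γ ‖f‖` for `t ≤
1`. Conversely, an increment `f x - f y` is at most `2 K(|x-y|, f)`, and the real interpolation
space is identified.

For the upper complex embedding, the three lines theorem is applied to `z ↦ F z x - F z y`, of size
`2M` on the left line and `2M|x-y|` on the right one.

For the lower one, `f` is a telescoping sum of Lipschitz differences `u n` between the scales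
`2^(-n)`, and `F z = exp (z² - θ²) Σ 2^(-n(z-θ)) u n` is admissible with `F θ = f`
(`complexInterpENorm_le_of_hasSum`). The gap `ϑ - θ` makes the series converge geometrically. -/

noncomputable section

open Complex.HadamardThreeLines Filter Topology

/-! ### Extended norms and embeddings -/

section Embeddings

variable {𝕜 V Y : Type*} [RCLike 𝕜] [NormedAddCommGroup V] [NormedSpace 𝕜 V]
  [NormedAddCommGroup Y] [NormedSpace 𝕜 Y]

theorem inclENorm_le (j : Y →L[𝕜] V) (y : Y) : inclENorm j (j y) ≤ ‖y‖ₑ :=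
  iInf₂_le (f := fun (z : Y) (_ : j z = j y) => ‖z‖ₑ) y rfl

theorem exists_of_inclENorm_lt_top {j : Y →L[𝕜] V} {x : V} (h : inclENorm j x < ∞) :
    ∃ y, j y = x := by
  simp only [inclENorm, iInf_lt_top] at h
  obtain ⟨y, hy, -⟩ := h
  exact ⟨y, hy⟩

theorem inclENorm_apply {j : Y →L[𝕜] V} (hj : Function.Injective j) (y : Y) :
    inclENorm j (j y) = ‖y‖ₑ := by
  refine le_antisymm (inclENorm_le j y) (le_iInf₂ fun z hz => ?_)
  rw [hj hz]

theorem contEmbeds_inclENorm {j : Y →L[𝕜] V} (hj : Function.Injective j) {M : V → ℝ≥0∞}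
    (C : ℝ≥0) (h : ∀ y, M (j y) ≤ C * ‖y‖ₑ) : ContEmbeds (inclENorm j) M := by
  refine ⟨C, fun x hx => ?_⟩
  obtain ⟨y, rfl⟩ := exists_of_inclENorm_lt_top hx
  rw [inclENorm_apply hj]
  exact h y

theorem ContEmbeds.lt_top {W : Type*} {N M : W → ℝ≥0∞} (h : ContEmbeds N M) {x : W}
    (hx : N x < ∞) : M x < ∞ := by
  obtain ⟨C, hC⟩ := h
  exact (hC x hx).trans_lt (ENNReal.mul_lt_top ENNReal.coe_lt_top hx)

theorem ContEmbeds.equalSpaces {W : Type*} {N M : W → ℝ≥0∞} (h₁ : ContEmbeds N M)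
    (h₂ : ContEmbeds M N) : EqualSpaces N M :=
  ⟨fun _ => ⟨h₁.lt_top, h₂.lt_top⟩, h₁, h₂⟩

end Embeddings

/-! ### Hölder spaces: norm bounds and completeness -/

section HolderBounds

variable {X : Type*} [MetricSpace X] [CompactSpace X] {𝕜 : Type*} [RCLike 𝕜] {γ : ℝ≥0}

theorem norm_holderIncl_le (f : HolderSpace X 𝕜 γ) : ‖holderIncl X 𝕜 γ f‖ ≤ ‖f‖ := by
  rw [HolderSpace.norm_def]
  exact le_add_of_nonneg_right (NNReal.coe_nonneg _)

theorem HolderSpace.norm_apply_sub_le (f : HolderSpace X 𝕜 γ) (x y : X) :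
    ‖holderIncl X 𝕜 γ f x - holderIncl X 𝕜 γ f y‖ ≤ ‖f‖ * dist x y ^ (γ : ℝ) := by
  have h := (memHolder_holderInclₗ f).holderWith.dist_le x y
  rw [dist_eq_norm] at h
  refine h.trans ?_
  rw [HolderSpace.norm_def]
  gcongr
  exact le_add_of_nonneg_left (norm_nonneg _)

theorem exists_holderSpace {f : C(X, 𝕜)} {A B : ℝ} (hA : ‖f‖ ≤ A) (hB : 0 ≤ B)
    (h : ∀ x y, ‖f x - f y‖ ≤ B * dist x y ^ (γ : ℝ)) :
    ∃ g : HolderSpace X 𝕜 γ, holderIncl X 𝕜 γ g = f ∧ ‖g‖ ≤ A + B := by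
  lift B to ℝ≥0 using hB
  have hf : HolderWith B γ f := by
    intro x y
    rw [edist_nndist, edist_nndist, ← ENNReal.coe_rpow_of_nonneg _ γ.coe_nonneg,
      ← ENNReal.coe_mul, ENNReal.coe_le_coe, ← NNReal.coe_le_coe]
    simpa [dist_eq_norm] using h x y
  let g : HolderSpace X 𝕜 γ := (⟨f, hf.memHolder⟩ : ↥(holderSubmodule X 𝕜 γ))
  refine ⟨g, rfl, ?_⟩
  rw [HolderSpace.norm_def]
  exact add_le_add hA (NNReal.coe_le_coe.2 hf.nnholderNorm_le)

theorem inclENorm_holderIncl_le {f : C(X, 𝕜)} {A B : ℝ} (hA : ‖f‖ ≤ A) (hB : 0 ≤ B)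
    (h : ∀ x y, ‖f x - f y‖ ≤ B * dist x y ^ (γ : ℝ)) :
    inclENorm (holderIncl X 𝕜 γ) f ≤ ENNReal.ofReal (A + B) := by
  obtain ⟨g, rfl, hg⟩ := exists_holderSpace hA hB h
  refine (inclENorm_le _ g).trans ?_
  rw [← ofReal_norm]
  exact ENNReal.ofReal_le_ofReal hg

/-- Hölder bounds on `u n - u m` survive the uniform limit in `m`, by evaluation at points.
Completeness is needed to sum series of boundary values in `C^{0,1}`. -/
instance : CompleteSpace (HolderSpace X 𝕜 γ) := by
  refine Metric.complete_of_cauchySeq_tendsto fun u hu => ?_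
  obtain ⟨g, hg⟩ := cauchySeq_tendsto_of_complete
    ((holderIncl X 𝕜 γ).uniformContinuous.comp_cauchySeq hu)
  have key : ∀ ε > 0, ∃ N, ∀ n ≥ N, ∃ v : HolderSpace X 𝕜 γ,
      holderIncl X 𝕜 γ v = holderIncl X 𝕜 γ (u n) - g ∧ ‖v‖ ≤ ε + ε := by
    intro ε hε
    obtain ⟨N, hN⟩ := Metric.cauchySeq_iff.1 hu ε hε
    refine ⟨N, fun n hn => ?_⟩
    have hlim : Tendsto (fun m => holderIncl X 𝕜 γ (u n - u m)) atTop
        (𝓝 (holderIncl X 𝕜 γ (u n) - g)) := by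
      simpa only [map_sub, Function.comp_apply] using hg.const_sub (holderIncl X 𝕜 γ (u n))
    have hnm : ∀ᶠ m in atTop, ‖u n - u m‖ ≤ ε := by
      filter_upwards [eventually_ge_atTop N] with m hm
      rw [← dist_eq_norm]
      exact (hN n hn m hm).le
    refine exists_holderSpace ?_ hε.le fun x y => ?_
    · refine le_of_tendsto hlim.norm ?_
      filter_upwards [hnm] with m hm using (norm_holderIncl_le _).trans hm
    · have hx := ((continuous_eval_const (F := C(X, 𝕜)) x).tendsto _).comp hlim
      have hy := ((continuous_eval_const (F := C(X, 𝕜)) y).tendsto _).comp hlim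
      refine le_of_tendsto (hx.sub hy).norm ?_
      filter_upwards [hnm] with m hm
      refine ((u n - u m).norm_apply_sub_le x y).trans ?_
      gcongr
  obtain ⟨N, hN⟩ := key 1 one_pos
  obtain ⟨v, hv, -⟩ := hN N le_rfl
  refine ⟨u N - v, Metric.tendsto_atTop.2 fun ε hε => ?_⟩
  obtain ⟨K, hK⟩ := key (ε / 3) (by positivity)
  refine ⟨K, fun n hn => ?_⟩
  obtain ⟨w, hw, hwε⟩ := hK n hn
  have : u n - (u N - v) = w := holderIncl_injective X 𝕜 γ (by
    rw [map_sub, map_sub, hv, hw]; abel)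
  rw [dist_eq_norm, this]
  linarith

end HolderBounds

/-! ### Lipschitz approximation of Hölder functions -/

section Approximation

/-- The first term dominates for `r ≤ t`, the second for `r ≥ t`. This puts a Hölder modulus below
an affine one of slope `t^(γ-1)`. -/
theorem Real.rpow_le_rpow_add_rpow_sub_one_mul {γ t r : ℝ} (hγ₀ : 0 ≤ γ) (hγ₁ : γ ≤ 1)
    (ht : 0 < t) (hr : 0 ≤ r) : r ^ γ ≤ t ^ γ + t ^ (γ - 1) * r := by
  rcases le_total r t with h | h
  · have := Real.rpow_le_rpow hr h hγ₀
    have : 0 ≤ t ^ (γ - 1) * r := by positivity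
    linarith
  · have hr' : 0 < r := ht.trans_le h
    have h1 : r ^ (γ - 1) ≤ t ^ (γ - 1) :=
      Real.rpow_le_rpow_of_nonpos ht h (by linarith)
    have h2 : r ^ γ = r ^ (γ - 1) * r := by
      rw [Real.rpow_sub_one hr'.ne', div_mul_cancel₀ _ hr'.ne']
    have : 0 ≤ t ^ γ := by positivity
    have := mul_le_mul_of_nonneg_right h1 hr
    linarith

/-- A Hölder continuous real function is approximated by its inf-convolution with a multiple of
the distance. -/
theorem exists_lipschitz_approx {X : Type*} [MetricSpace X] {φ : X → ℝ} {H γ t : ℝ} (hH : 0 ≤ H)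
    (hγ₀ : 0 ≤ γ) (hγ₁ : γ ≤ 1) (ht : 0 < t) (hφ : ∀ x y, |φ x - φ y| ≤ H * dist x y ^ γ) :
    ∃ g : X → ℝ, (∀ x y, |g x - g y| ≤ H * t ^ (γ - 1) * dist x y) ∧
      ∀ x, |φ x - g x| ≤ H * t ^ γ := by
  set L := H * t ^ (γ - 1) with hL
  have hL₀ : 0 ≤ L := by positivity
  -- Used twice: it makes the infimum finite and bounds the approximation error.
  have hlow : ∀ x y, φ x - H * t ^ γ ≤ φ y + L * dist x y := by
    intro x y
    have h1 := (abs_le.1 (hφ x y)).2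
    have h2 := mul_le_mul_of_nonneg_left
      (Real.rpow_le_rpow_add_rpow_sub_one_mul hγ₀ hγ₁ ht (dist_nonneg (x := x) (y := y))) hH
    rw [mul_add, ← mul_assoc] at h2
    linarith
  have hbdd : ∀ x, BddBelow (Set.range fun y => φ y + L * dist x y) := fun x =>
    ⟨φ x - H * t ^ γ, by rintro _ ⟨y, rfl⟩; exact hlow x y⟩
  have hlip : ∀ x y, (⨅ z, φ z + L * dist x z) - (⨅ z, φ z + L * dist y z) ≤ L * dist x y := by
    intro x y
    have : Nonempty X := ⟨x⟩
    rw [sub_le_iff_le_add, ← sub_le_iff_le_add']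
    refine le_ciInf fun z => ?_
    have h1 := ciInf_le (hbdd x) z
    have h2 := mul_le_mul_of_nonneg_left (dist_triangle x y z) hL₀
    linarith
  refine ⟨fun x => ⨅ y, φ y + L * dist x y, fun x y => ?_, fun x => ?_⟩
  · rw [abs_le]
    have h1 := hlip x y
    have h2 := hlip y x
    rw [dist_comm y x] at h2
    exact ⟨by linarith, h1⟩
  · have : Nonempty X := ⟨x⟩
    have h1 := ciInf_le (hbdd x) x
    have h2 := le_ciInf (hlow x)
    simp only [dist_self, mul_zero, add_zero] at h1
    have h3 : 0 ≤ H * t ^ γ := by positivity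
    rw [abs_le]
    exact ⟨by linarith, by linarith⟩

variable {X : Type*} [MetricSpace X] [CompactSpace X] {𝕜 : Type*} [RCLike 𝕜] {γ : ℝ≥0}

theorem RCLike.norm_ofReal_add_ofReal_mul_I_le (a b : ℝ) :
    ‖(a : 𝕜) + b * RCLike.I‖ ≤ |a| + |b| := by
  refine (norm_add_le _ _).trans ?_
  rw [norm_mul, RCLike.norm_ofReal, RCLike.norm_ofReal]
  -- Over `ℝ` the unit `I` is `0`.
  have : ‖(RCLike.I : 𝕜)‖ ≤ 1 := by
    rcases eq_or_ne (RCLike.I : 𝕜) 0 with h | h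
    · simp [h]
    · exact (RCLike.norm_I_of_ne_zero h).le
  gcongr
  exact mul_le_of_le_one_right (abs_nonneg b) this

/-- Real and imaginary parts are approximated separately, which doubles the constants. The 7 is `2 +
1 + 2 + 2`: the error, then `t` times the sup norm bound (two terms) and the Lipschitz constant of
`b`, each compared with `t^γ` through `t ≤ 1`. -/
theorem HolderSpace.exists_lipschitz_approx (hγ : γ ≤ 1) (f : HolderSpace X 𝕜 γ) {t : ℝ}
    (ht : 0 < t) (ht₁ : t ≤ 1) : ∃ b : HolderSpace X 𝕜 1,
      ‖holderIncl X 𝕜 γ f - holderIncl X 𝕜 1 b‖ + t * ‖b‖ ≤ 7 * t ^ (γ : ℝ) * ‖f‖ := by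
  set φ := holderIncl X 𝕜 γ f with hφ
  have hH := norm_nonneg f
  have hre : ∀ x y, |RCLike.re (φ x) - RCLike.re (φ y)| ≤ ‖f‖ * dist x y ^ (γ : ℝ) := fun x y => by
    rw [← map_sub]
    exact (RCLike.abs_re_le_norm _).trans (f.norm_apply_sub_le x y)
  have him : ∀ x y, |RCLike.im (φ x) - RCLike.im (φ y)| ≤ ‖f‖ * dist x y ^ (γ : ℝ) := fun x y => by
    rw [← map_sub]
    exact (RCLike.abs_im_le_norm _).trans (f.norm_apply_sub_le x y)
  have hγ' : (γ : ℝ) ≤ 1 := by exact_mod_cast hγ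
  obtain ⟨g₁, hl₁, ha₁⟩ := _root_.exists_lipschitz_approx hH γ.coe_nonneg hγ' ht hre
  obtain ⟨g₂, hl₂, ha₂⟩ := _root_.exists_lipschitz_approx hH γ.coe_nonneg hγ' ht him
  have hL : 0 ≤ ‖f‖ * t ^ ((γ : ℝ) - 1) := by positivity
  have hg : ∀ x y, ‖((g₁ x : 𝕜) + g₂ x * RCLike.I) - (g₁ y + g₂ y * RCLike.I)‖ ≤
      2 * (‖f‖ * t ^ ((γ : ℝ) - 1)) * dist x y := fun x y => by
    have : ((g₁ x : 𝕜) + g₂ x * RCLike.I) - (g₁ y + g₂ y * RCLike.I) =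
        ((g₁ x - g₁ y : ℝ) : 𝕜) + ((g₂ x - g₂ y : ℝ) : 𝕜) * RCLike.I := by
      push_cast; ring
    rw [this]
    refine (RCLike.norm_ofReal_add_ofReal_mul_I_le _ _).trans ?_
    linarith [hl₁ x y, hl₂ x y]
  have hcont : Continuous fun x => ((g₁ x : 𝕜) + g₂ x * RCLike.I) :=
    (LipschitzWith.of_dist_le_mul (K := ⟨_, mul_nonneg zero_le_two hL⟩) fun x y => by
      rw [dist_eq_norm]; exact hg x y).continuous
  set b₀ : C(X, 𝕜) := ⟨_, hcont⟩ with hb₀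
  have happ : ‖φ - b₀‖ ≤ 2 * (‖f‖ * t ^ (γ : ℝ)) := by
    refine (ContinuousMap.norm_le _ (by positivity)).2 fun x => ?_
    have : (φ - b₀) x = ((RCLike.re (φ x) - g₁ x : ℝ) : 𝕜) +
        ((RCLike.im (φ x) - g₂ x : ℝ) : 𝕜) * RCLike.I := by
      conv_lhs => rw [ContinuousMap.sub_apply, ← RCLike.re_add_im (φ x)]
      simp only [hb₀, ContinuousMap.coe_mk]
      push_cast; ring
    rw [this]
    refine (RCLike.norm_ofReal_add_ofReal_mul_I_le _ _).trans ?_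
    linarith [ha₁ x, ha₂ x]
  have hb₀n : ‖b₀‖ ≤ ‖f‖ + 2 * (‖f‖ * t ^ (γ : ℝ)) := by
    have h1 : ‖b₀‖ ≤ ‖φ‖ + ‖φ - b₀‖ := norm_le_norm_add_norm_sub φ b₀
    have h2 : ‖φ‖ ≤ ‖f‖ := norm_holderIncl_le f
    linarith
  obtain ⟨b, hb, hbn⟩ := exists_holderSpace (γ := 1) hb₀n (mul_nonneg zero_le_two hL)
    (fun x y => by rw [NNReal.coe_one, Real.rpow_one]; exact hg x y)
  refine ⟨b, ?_⟩
  rw [hb]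
  have ht₂ : t ≤ t ^ (γ : ℝ) := by
    simpa using Real.rpow_le_rpow_of_exponent_ge ht ht₁ hγ'
  have ht₃ : t * t ^ ((γ : ℝ) - 1) = t ^ (γ : ℝ) := by
    rw [Real.rpow_sub_one ht.ne', mul_div_cancel₀ _ ht.ne']
  have ht₄ : t * t ^ (γ : ℝ) ≤ t ^ (γ : ℝ) :=
    mul_le_of_le_one_left (by positivity) ht₁
  calc ‖φ - b₀‖ + t * ‖b‖
      ≤ 2 * (‖f‖ * t ^ (γ : ℝ)) +
        t * (‖f‖ + 2 * (‖f‖ * t ^ (γ : ℝ)) + 2 * (‖f‖ * t ^ ((γ : ℝ) - 1))) := by gcongr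
    _ = (2 * t ^ (γ : ℝ) + t + 2 * (t * t ^ (γ : ℝ)) + 2 * (t * t ^ ((γ : ℝ) - 1))) * ‖f‖ := by
        ring
    _ ≤ 7 * t ^ (γ : ℝ) * ‖f‖ := by
        gcongr
        linarith

end Approximation

/-! ### Real interpolation -/

section RealInterpolation

variable {𝕜 X Y : Type*} [RCLike 𝕜] [NormedAddCommGroup X] [NormedSpace 𝕜 X]
  [NormedAddCommGroup Y] [NormedSpace 𝕜 Y]

theorem kFunctional_le (j : Y →L[𝕜] X) {t : ℝ} (ht : 0 ≤ t) (x : X) (b : Y) :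
    kFunctional j t x ≤ ‖x - j b‖ + t * ‖b‖ :=
  ciInf_le ⟨0, by rintro _ ⟨y, rfl⟩; positivity⟩ b

theorem kFunctional_le_of_realInterpENorm_lt_top {j : Y →L[𝕜] X} {θ : ℝ} {x : X}
    (h : realInterpENorm j θ x < ∞) {t : ℝ} (ht : 0 < t) :
    kFunctional j t x ≤ (realInterpENorm j θ x).toReal * t ^ θ := by
  have h1 : ENNReal.ofReal (t ^ (-θ) * kFunctional j t x) ≤ realInterpENorm j θ x :=
    le_iSup₂_of_le t ht le_rfl
  rw [ENNReal.ofReal_le_iff_le_toReal h.ne, Real.rpow_neg ht.le,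
    inv_mul_le_iff₀ (by positivity)] at h1
  rwa [mul_comm]

theorem realInterpENorm_le {j : Y →L[𝕜] X} {θ : ℝ} {x : X} {C : ℝ}
    (h : ∀ t, 0 < t → kFunctional j t x ≤ C * t ^ θ) :
    realInterpENorm j θ x ≤ ENNReal.ofReal C := by
  refine iSup₂_le fun t ht => ENNReal.ofReal_le_ofReal ?_
  rw [Real.rpow_neg ht.le, inv_mul_le_iff₀ (by positivity), mul_comm]
  exact h t ht

end RealInterpolation

section RealInterpolationHolder

variable (X : Type*) [MetricSpace X] [CompactSpace X] (𝕜 : Type*) [RCLike 𝕜] {θ : ℝ≥0}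

theorem contEmbeds_holder_realInterp (hθ : θ ≤ 1) :
    ContEmbeds (inclENorm (holderIncl X 𝕜 θ)) (realInterpENorm (holderIncl X 𝕜 1) θ) := by
  refine contEmbeds_inclENorm (holderIncl_injective X 𝕜 θ) 7 fun f => ?_
  have : ((7 : ℝ≥0) : ℝ≥0∞) * ‖f‖ₑ = ENNReal.ofReal (7 * ‖f‖) := by
    rw [ENNReal.ofReal_mul (by norm_num), ofReal_norm]
    simp
  rw [this]
  refine realInterpENorm_le fun t ht => ?_
  rcases le_total t 1 with ht₁ | ht₁
  · obtain ⟨b, hb⟩ := f.exists_lipschitz_approx hθ ht ht₁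
    refine (kFunctional_le _ ht.le _ b).trans (hb.trans_eq (by ring))
  -- For large `t` the trivial splitting `b = 0` suffices, since `t^θ ≥ 1`.
  · refine (kFunctional_le _ ht.le _ 0).trans ?_
    have h1 := norm_holderIncl_le f
    have h2 := Real.one_le_rpow ht₁ θ.coe_nonneg
    simp only [map_zero, sub_zero, norm_zero, mul_zero, add_zero]
    nlinarith [norm_nonneg f]

/-- The K-functional at `t = 1` controls the sup norm, and at `t = dist x y` the increment: the part
in `C` contributes twice its norm, the Lipschitz part `t ‖b‖`. Hence `3 = 1 + 2`. -/
theorem contEmbeds_realInterp_holder :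
    ContEmbeds (realInterpENorm (holderIncl X 𝕜 1) θ) (inclENorm (holderIncl X 𝕜 θ)) := by
  refine ⟨3, fun f hf => ?_⟩
  set S := (realInterpENorm (holderIncl X 𝕜 1) θ f).toReal with hS
  have hS₀ : 0 ≤ S := ENNReal.toReal_nonneg
  have hK : ∀ t, 0 < t → kFunctional (holderIncl X 𝕜 1) t f ≤ S * t ^ (θ : ℝ) := fun t ht =>
    kFunctional_le_of_realInterpENorm_lt_top hf ht
  have h0 : ‖f‖ ≤ S := by
    refine le_trans (le_ciInf fun b => ?_) ((hK 1 one_pos).trans_eq (by simp))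
    have h1 := norm_holderIncl_le b
    have h2 : ‖f‖ ≤ ‖f - holderIncl X 𝕜 1 b‖ + ‖holderIncl X 𝕜 1 b‖ := norm_le_norm_sub_add _ _
    linarith
  have h1 : ∀ x y, ‖f x - f y‖ ≤ 2 * S * dist x y ^ (θ : ℝ) := by
    intro x y
    rcases eq_or_ne x y with rfl | hxy
    · simp only [sub_self, norm_zero]
      positivity
    have hd : 0 < dist x y := dist_pos.2 hxy
    have : ‖f x - f y‖ / 2 ≤ kFunctional (holderIncl X 𝕜 1) (dist x y) f := by
      refine le_ciInf fun b => ?_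
      have e : f x - f y = (f - holderIncl X 𝕜 1 b) x - (f - holderIncl X 𝕜 1 b) y +
          (holderIncl X 𝕜 1 b x - holderIncl X 𝕜 1 b y) := by
        simp only [ContinuousMap.sub_apply]; ring
      have hb := b.norm_apply_sub_le x y
      rw [NNReal.coe_one, Real.rpow_one] at hb
      have hx := (f - holderIncl X 𝕜 1 b).norm_coe_le_norm x
      have hy := (f - holderIncl X 𝕜 1 b).norm_coe_le_norm y
      have h2 := norm_add_le ((f - holderIncl X 𝕜 1 b) x - (f - holderIncl X 𝕜 1 b) y)
          (holderIncl X 𝕜 1 b x - holderIncl X 𝕜 1 b y)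
      rw [← e] at h2
      have h3 := norm_sub_le ((f - holderIncl X 𝕜 1 b) x) ((f - holderIncl X 𝕜 1 b) y)
      have h4 : 0 ≤ ‖b‖ * dist x y := by positivity
      linarith
    linarith [hK _ hd]
  refine (inclENorm_holderIncl_le h0 (by positivity) h1).trans ?_
  rw [show S + 2 * S = 3 * S by ring, ENNReal.ofReal_mul (by norm_num), hS,
    ENNReal.ofReal_toReal hf.ne]
  simp

theorem equalSpaces_realInterp_holder (hθ : θ ≤ 1) :
    EqualSpaces (realInterpENorm (holderIncl X 𝕜 1) θ) (inclENorm (holderIncl X 𝕜 θ)) :=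
  (contEmbeds_realInterp_holder X 𝕜).equalSpaces (contEmbeds_holder_realInterp X 𝕜 hθ)

end RealInterpolationHolder

/-! ### Three lines theorem and the upper complex embedding -/

section ThreeLines

/-- The interpolated bound is `A^(1-θ) (A r)^θ`. It serves with `r = 1` for sup norms and `r = dist
x y` for increments. -/
theorem norm_le_mul_rpow_of_strip {W : Type*} [NormedAddCommGroup W] [NormedSpace ℂ W]
    {f : ℂ → W} (hc : ContinuousOn f (verticalClosedStrip 0 1))
    (hd : DifferentiableOn ℂ f (verticalStrip 0 1))
    (hB : ∃ C, ∀ z ∈ verticalClosedStrip 0 1, ‖f z‖ ≤ C) {A r : ℝ} (hA : 0 ≤ A) (hr : 0 ≤ r)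
    (h₀ : ∀ s : ℝ, ‖f (s * Complex.I)‖ ≤ A) (h₁ : ∀ s : ℝ, ‖f (1 + s * Complex.I)‖ ≤ A * r)
    {θ : ℝ} (hθ₀ : 0 ≤ θ) (hθ₁ : θ ≤ 1) : ‖f θ‖ ≤ A * r ^ θ := by
  have hcl : closure (verticalStrip 0 1) ⊆ verticalClosedStrip 0 1 :=
    closure_minimal (Set.preimage_mono Set.Ioo_subset_Icc_self)
      (isClosed_Icc.preimage Complex.continuous_re)
  have hmem : (θ : ℂ) ∈ verticalClosedStrip 0 1 := by
    simp [verticalClosedStrip, hθ₀, hθ₁]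
  have hB' : BddAbove ((norm ∘ f) '' verticalClosedStrip 0 1) := by
    obtain ⟨C, hC⟩ := hB
    exact ⟨C, by rintro _ ⟨z, hz, rfl⟩; exact hC z hz⟩
  have key := norm_le_interp_of_mem_verticalClosedStrip' zero_lt_one hmem
    ⟨hd, hc.mono hcl⟩ hB' (a := A) (b := A * r) ?_ ?_
  · refine key.trans_eq ?_
    simp only [Complex.ofReal_re, sub_zero, div_one]
    rw [Real.mul_rpow hA hr, ← mul_assoc, ← Real.rpow_add_of_nonneg hA (by linarith) hθ₀]
    simp
  · intro z hz
    have hz' : z.re = 0 := hz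
    have : z = z.im * Complex.I := by apply Complex.ext <;> simp [hz']
    rw [this]
    exact h₀ _
  · intro z hz
    have hz' : z.re = 1 := hz
    have : z = 1 + z.im * Complex.I := by apply Complex.ext <;> simp [hz']
    rw [this]
    exact h₁ _

end ThreeLines

section ComplexInterpolationUpper

variable (X : Type*) [MetricSpace X] [CompactSpace X] {θ : ℝ≥0}

theorem CalderonFun.inclENorm_holder_le {X : Type*} [MetricSpace X] [CompactSpace X]
    (F : CalderonFun (holderIncl X ℂ 1)) (hθ : θ ≤ 1) :
    inclENorm (holderIncl X ℂ θ) (F.toFun (θ : ℝ)) ≤ (3 : ℝ≥0) * F.eNorm := by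
  rcases eq_or_ne F.eNorm ∞ with hF | hF
  · simp [hF]
  set M := F.eNorm.toReal with hM
  have hM₀ : 0 ≤ M := ENNReal.toReal_nonneg
  have hθ' : (θ : ℝ) ≤ 1 := by exact_mod_cast hθ
  have hl : ∀ s : ℝ, ‖F.toFun (s * Complex.I)‖ ≤ M := fun s => by
    rw [hM, ← ENNReal.ofReal_le_iff_le_toReal hF, ofReal_norm]
    exact (le_iSup (fun s : ℝ => ‖F.toFun (s * Complex.I)‖ₑ) s).trans (le_max_left _ _)
  have hr : ∀ s : ℝ, ‖F.bdry s‖ ≤ M := fun s => by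
    rw [hM, ← ENNReal.ofReal_le_iff_le_toReal hF, ofReal_norm]
    exact (le_iSup (fun s : ℝ => ‖F.bdry s‖ₑ) s).trans (le_max_right _ _)
  have h0 : ‖F.toFun (θ : ℝ)‖ ≤ M := by
    have := norm_le_mul_rpow_of_strip F.continuousOn F.differentiableOn F.bounded hM₀ zero_le_one
      hl (fun s => by
        rw [F.bdry_eq, mul_one]
        exact (norm_holderIncl_le _).trans (hr s)) θ.coe_nonneg hθ'
    simpa using this
  have h1 : ∀ x y, ‖F.toFun (θ : ℝ) x - F.toFun (θ : ℝ) y‖ ≤ 2 * M * dist x y ^ (θ : ℝ) := by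
    intro x y
    let T : C(X, ℂ) →L[ℂ] ℂ := ContinuousMap.evalCLM ℂ x - ContinuousMap.evalCLM ℂ y
    have hT : ∀ g : C(X, ℂ), T g = g x - g y := fun g => rfl
    have hTn : ∀ g : C(X, ℂ), ‖g x - g y‖ ≤ 2 * ‖g‖ := fun g => by
      linarith [norm_sub_le (g x) (g y), g.norm_coe_le_norm x, g.norm_coe_le_norm y]
    refine norm_le_mul_rpow_of_strip (f := fun z => F.toFun z x - F.toFun z y) (A := 2 * M)
      (T.continuous.comp_continuousOn F.continuousOn)
      (T.differentiable.comp_differentiableOn F.differentiableOn) ?_ (by positivity) dist_nonneg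
      (fun s => ?_) (fun s => ?_) θ.coe_nonneg hθ'
    · obtain ⟨C, hC⟩ := F.bounded
      exact ⟨2 * C, fun z hz => (hTn _).trans (by linarith [hC z hz])⟩
    · exact (hTn _).trans (by linarith [hl s])
    · have hb := (F.bdry s).norm_apply_sub_le x y
      rw [NNReal.coe_one, Real.rpow_one] at hb
      simp only [F.bdry_eq]
      have := mul_le_mul_of_nonneg_right (hr s) (dist_nonneg (x := x) (y := y))
      have : 0 ≤ M * dist x y := by positivity
      linarith
  refine (inclENorm_holderIncl_le h0 (by positivity) h1).trans ?_
  rw [show M + 2 * M = 3 * M by ring, ENNReal.ofReal_mul (by norm_num), hM,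
    ENNReal.ofReal_toReal hF]
  simp

theorem inclENorm_le_complexInterpHolderC (hθ : θ ≤ 1) (f : C(X, ℂ)) :
    inclENorm (holderIncl X ℂ θ) f ≤ (3 : ℝ≥0) * complexInterpHolderC X θ f := by
  simp only [complexInterpHolderC, complexInterpENorm,
    ENNReal.mul_iInf_of_ne (ENNReal.coe_ne_zero.2 (three_ne_zero' ℝ≥0)) ENNReal.coe_ne_top]
  refine le_iInf₂ fun F hF => ?_
  rw [← hF]
  exact F.inclENorm_holder_le hθ

theorem contEmbeds_complexInterpHolderC_holder (hθ : θ ≤ 1) :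
    ContEmbeds (complexInterpHolderC X θ) (inclENorm (holderIncl X ℂ θ)) :=
  ⟨3, fun f _ => inclENorm_le_complexInterpHolderC X hθ f⟩

theorem inclENorm_complexify (f : C(X, ℝ)) :
    inclENorm (holderIncl X ℂ θ) (complexify X f) = inclENorm (holderIncl X ℝ θ) f := by
  have hn : ‖complexify X f‖ = ‖f‖ := by
    refine le_antisymm ((ContinuousMap.norm_le _ (norm_nonneg _)).2 fun x => ?_)
      ((ContinuousMap.norm_le _ (norm_nonneg _)).2 fun x => ?_)
    · exact (Complex.norm_real _).trans_le (f.norm_coe_le_norm x)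
    · exact (Complex.norm_real _).symm.trans_le ((complexify X f).norm_coe_le_norm x)
  have hs : ∀ x y, ‖complexify X f x - complexify X f y‖ = ‖f x - f y‖ := fun x y => by
    rw [← Complex.norm_real]
    simp [complexify]
  -- Sup norm and seminorm are transferred separately, so no constant is lost.
  have hnorm : ∀ {𝕜 : Type} [RCLike 𝕜] (g : HolderSpace X 𝕜 θ), ENNReal.ofReal
      (‖holderInclₗ X 𝕜 θ g‖ + (nnHolderNorm θ (holderInclₗ X 𝕜 θ g : X → 𝕜) : ℝ)) = ‖g‖ₑ :=
    fun g => by rw [← HolderSpace.norm_def, ofReal_norm]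
  have hh : ∀ {𝕜 : Type} [RCLike 𝕜] (g : HolderSpace X 𝕜 θ) (x y : X),
      ‖holderIncl X 𝕜 θ g x - holderIncl X 𝕜 θ g y‖ ≤
        (nnHolderNorm θ (holderInclₗ X 𝕜 θ g : X → 𝕜) : ℝ) * dist x y ^ (θ : ℝ) :=
    fun g x y => by
      rw [← dist_eq_norm]
      exact (memHolder_holderInclₗ g).holderWith.dist_le x y
  refine le_antisymm (le_iInf₂ fun g hg => ?_) (le_iInf₂ fun g hg => ?_)
  · refine (inclENorm_holderIncl_le (hn.trans_le (le_of_eq ?_)) (NNReal.coe_nonneg _)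
      fun x y => ?_).trans_eq (hnorm g)
    · rw [← hg]; rfl
    · rw [hs, ← hg]
      exact hh g x y
  · refine (inclENorm_holderIncl_le (hn.symm.trans_le (le_of_eq ?_)) (NNReal.coe_nonneg _)
      fun x y => ?_).trans_eq (hnorm g)
    · rw [← hg]; rfl
    · rw [← hs, ← hg]
      exact hh g x y

end ComplexInterpolationUpper

/-! ### Admissible functions built from series -/

section ComplexInterpolationLower

variable {X Y : Type*} [NormedAddCommGroup X] [NormedSpace ℂ X] [CompleteSpace X]
  [NormedAddCommGroup Y] [NormedSpace ℂ Y] [CompleteSpace Y]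

theorem norm_exp_neg_mul_log_two_mul (n : ℕ) (w : ℂ) :
    ‖Complex.exp (-(n * Real.log 2 * w))‖ = (2 : ℝ) ^ (-(n * w.re)) := by
  rw [Complex.norm_exp, Real.rpow_def_of_pos two_pos]
  congr 1
  have : ((n : ℂ) * Real.log 2 * w) = ((n * Real.log 2 : ℝ) : ℂ) * w := by push_cast; ring
  rw [this, Complex.neg_re, Complex.re_ofReal_mul]
  ring

theorem norm_exp_sq_sub (z : ℂ) (a : ℝ) :
    ‖Complex.exp (z ^ 2 - a)‖ = Real.exp (z.re ^ 2 - z.im ^ 2 - a) := by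
  rw [Complex.norm_exp]
  congr 1
  simp [pow_two, Complex.mul_re]

/-- On a vertical line `exp (z²)` decays like a Gaussian, so it turns bounded boundary values into
ones vanishing at infinity. -/
theorem tendsto_exp_sq_sub_smul (a c : ℝ) {W : Type*} [NormedAddCommGroup W]
    [NormedSpace ℂ W] {g : ℝ → W} {B : ℝ} (hg : ∀ s, ‖g s‖ ≤ B) :
    Tendsto (fun s : ℝ => Complex.exp ((c + s * Complex.I) ^ 2 - a) • g s) (cocompact ℝ) (𝓝 0) := by
  have h1 : Tendsto (fun s : ℝ => Real.exp (c ^ 2 - s ^ 2 - a) * B) (cocompact ℝ) (𝓝 0) := by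
    rw [← zero_mul B]
    refine Tendsto.mul_const B (Real.tendsto_exp_atBot.comp ?_)
    have h2 : Tendsto (fun s : ℝ => s ^ 2) (cocompact ℝ) atTop := by
      have := (tendsto_pow_atTop (α := ℝ) two_ne_zero).comp (tendsto_norm_cocompact_atTop (E := ℝ))
      simpa [Function.comp_def] using this
    have := tendsto_atBot_add_const_right _ (c ^ 2 - a) (tendsto_neg_atTop_atBot.comp h2)
    refine this.congr fun s => ?_
    simp only [Function.comp_apply]
    ring
  refine squeeze_zero_norm (fun s => ?_) h1
  rw [norm_smul, norm_exp_sq_sub]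
  simpa using mul_le_mul_of_nonneg_left (hg s) (Real.exp_pos (c ^ 2 - s ^ 2 - a)).le

theorem norm_exp_neg_mul_log_two_smul_le {W : Type*} [NormedAddCommGroup W] [NormedSpace ℂ W]
    {n : ℕ} {w : ℂ} {v : W} {B r η : ℝ} (hB : 0 ≤ B) (hv : ‖v‖ ≤ B * 2 ^ (n * r))
    (h : η ≤ w.re - r) :
    ‖Complex.exp (-(n * Real.log 2 * w)) • v‖ ≤ B * 2 ^ (-(n * η)) := by
  rw [norm_smul, norm_exp_neg_mul_log_two_mul]
  calc (2 : ℝ) ^ (-(n * w.re)) * ‖v‖ ≤ 2 ^ (-(n * w.re)) * (B * 2 ^ (n * r)) := by gcongr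
    _ = B * (2 ^ (-(n * w.re)) * 2 ^ (n * r)) := by ring
    _ = B * 2 ^ (-(n * (w.re - r))) := by
        rw [← Real.rpow_add two_pos]; congr 2; ring
    _ ≤ B * 2 ^ (-(n * η)) := by
        gcongr
        exact one_le_two

theorem summable_two_rpow_neg_mul {η : ℝ} (hη : 0 < η) :
    Summable fun n : ℕ => (2 : ℝ) ^ (-(n * η)) := by
  have : ∀ n : ℕ, (2 : ℝ) ^ (-(n * η)) = ((2 : ℝ) ^ (-η)) ^ n := fun n => by
    rw [← Real.rpow_natCast, ← Real.rpow_mul two_pos.le]; congr 1; ring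
  simp only [this]
  exact summable_geometric_of_lt_one (by positivity)
    (Real.rpow_lt_one_of_one_lt_of_neg one_lt_two (by linarith))

/-- If `x` is the sum of a series in the couple whose terms decay at a rate better than the one
corresponding to `θ`, then `x` belongs to the complex interpolation space. -/
theorem complexInterpENorm_le_of_hasSum (j : Y →L[ℂ] X) {θ ϑ : ℝ} (hϑ : θ < ϑ) :
    ∃ C : ℝ≥0, ∀ (x : X) (u : ℕ → Y) (B : ℝ), 0 ≤ B →
      HasSum (fun n => j (u n)) x → (∀ n : ℕ, ‖j (u n)‖ ≤ B * 2 ^ (n * (-ϑ))) →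
      (∀ n : ℕ, ‖u n‖ ≤ B * 2 ^ (n * (1 - ϑ))) →
      complexInterpENorm j θ x ≤ C * ENNReal.ofReal B := by
  -- Half of the gap pays for the decay `2^(-nη)`, the other half for convergence on the open
  -- half-plane `re z > -η`. It contains the closed strip, so holomorphy there also gives continuity
  -- up to the boundary.
  obtain ⟨η, hη, hηϑ⟩ : ∃ η : ℝ, 0 < η ∧ θ + 2 * η = ϑ := ⟨(ϑ - θ) / 2, by linarith, by ring⟩
  have hsum := summable_two_rpow_neg_mul hη
  set S := ∑' n : ℕ, (2 : ℝ) ^ (-(n * η)) with hS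
  have hS₀ : 0 ≤ S := tsum_nonneg fun n => by positivity
  refine ⟨(Real.exp 1 * S).toNNReal, fun x u B hB hx hX hY => ?_⟩
  have hsumB : Summable fun n : ℕ => B * (2 : ℝ) ^ (-(n * η)) := hsum.mul_left B
  have hSB : ∑' n : ℕ, B * (2 : ℝ) ^ (-(n * η)) = B * S := tsum_mul_left
  let e : ℕ → ℂ → ℂ := fun n w => Complex.exp (-(n * Real.log 2 * w))
  have he : ∀ n, Differentiable ℂ fun z : ℂ => e n (z - θ) := fun n =>
    (((differentiable_id.sub_const _).const_mul _).neg).cexp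
  let U : Set ℂ := Complex.re ⁻¹' Set.Ioi (-η)
  have hU : IsOpen U := isOpen_Ioi.preimage Complex.continuous_re
  have hstrip : verticalClosedStrip 0 1 ⊆ U := fun z hz => by
    have : 0 ≤ z.re := hz.1
    exact (show -η < z.re by linarith)
  have hGle : ∀ (n : ℕ) (z : ℂ), z ∈ U → ‖e n (z - θ) • j (u n)‖ ≤ B * 2 ^ (-(n * η)) :=
    fun n z hz => norm_exp_neg_mul_log_two_smul_le hB (hX n) (by
      have : -η < z.re := hz
      simp only [Complex.sub_re, Complex.ofReal_re]
      linarith)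
  have hgle : ∀ (n : ℕ) (s : ℝ), ‖e n (1 + s * Complex.I - θ) • u n‖ ≤ B * 2 ^ (-(n * η)) :=
    fun n s => norm_exp_neg_mul_log_two_smul_le hB (hY n) (by
      simp
      linarith)
  let G : ℂ → X := fun z => ∑' n, e n (z - θ) • j (u n)
  let g : ℝ → Y := fun s => ∑' n, e n (1 + s * Complex.I - θ) • u n
  have hGd : DifferentiableOn ℂ G U := Complex.differentiableOn_tsum_of_summable_norm hsumB
    (fun n => ((he n).smul_const _).differentiableOn) hU hGle
  have hGn : ∀ z ∈ U, ‖G z‖ ≤ B * S := fun z hz =>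
    hSB ▸ tsum_of_norm_bounded hsumB.hasSum fun n => hGle n z hz
  have hgc : Continuous g := continuous_tsum
    (fun n => ((he n).continuous.comp (by fun_prop)).smul continuous_const) hsumB hgle
  have hgn : ∀ s, ‖g s‖ ≤ B * S := fun s =>
    hSB ▸ tsum_of_norm_bounded hsumB.hasSum fun n => hgle n s
  have hjg : ∀ s : ℝ, G (1 + s * Complex.I) = j (g s) := fun s => by
    rw [ContinuousLinearMap.map_tsum j (Summable.of_norm_bounded hsumB fun n => hgle n s)]
    simp only [G, map_smul]
  -- Normalised to equal 1 at `θ`.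
  let p : ℂ → ℂ := fun z => Complex.exp (z ^ 2 - (θ ^ 2 : ℝ))
  have hp : Differentiable ℂ p := ((differentiable_id.pow 2).sub_const _).cexp
  have hpn : ∀ z ∈ verticalClosedStrip 0 1, ‖p z‖ ≤ Real.exp 1 := fun z hz => by
    rw [norm_exp_sq_sub]
    have h0 : 0 ≤ z.re := hz.1
    have h1 : z.re ≤ 1 := hz.2
    exact Real.exp_le_exp.2 (by nlinarith [sq_nonneg z.im, sq_nonneg θ])
  have hFd : DifferentiableOn ℂ (fun z => p z • G z) U := hp.differentiableOn.smul hGd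
  have hl : ∀ s : ℝ, (s * Complex.I : ℂ) ∈ verticalClosedStrip 0 1 := fun s => by
    simp [verticalClosedStrip]
  have hr : ∀ s : ℝ, (1 + s * Complex.I : ℂ) ∈ verticalClosedStrip 0 1 := fun s => by
    simp [verticalClosedStrip]
  have hFn : ∀ z ∈ verticalClosedStrip 0 1, ‖p z • G z‖ ≤ Real.exp 1 * S * B := fun z hz => by
    rw [norm_smul, mul_assoc, mul_comm S]
    exact mul_le_mul (hpn z hz) (hGn z (hstrip hz)) (norm_nonneg _) (Real.exp_pos _).le
  let F : CalderonFun j :=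
    { toFun := fun z => p z • G z
      bdry := fun s => p (1 + s * Complex.I) • g s
      continuousOn := hFd.continuousOn.mono hstrip
      differentiableOn := hFd.mono fun z hz => hstrip (Set.Ioo_subset_Icc_self hz)
      bounded := ⟨_, hFn⟩
      bdry_eq := fun s => by rw [hjg, map_smul]
      continuous_bdry := (hp.continuous.comp (by fun_prop)).smul hgc
      tendsto_left := by
        simpa using tendsto_exp_sq_sub_smul (θ ^ 2) 0 fun s => hGn _ (hstrip (hl s))
      tendsto_right := by
        simpa using tendsto_exp_sq_sub_smul (θ ^ 2) 1 hgn }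
  have hFθ : F.toFun (θ : ℂ) = x := by
    simp [F, p, G, e, hx.tsum_eq]
  refine (iInf₂_le (f := fun (F : CalderonFun j) (_ : F.toFun (θ : ℂ) = x) => F.eNorm)
    F hFθ).trans ?_
  have hC : ((Real.exp 1 * S).toNNReal : ℝ≥0∞) * ENNReal.ofReal B =
      ENNReal.ofReal (Real.exp 1 * S * B) :=
    (ENNReal.ofReal_mul (by positivity)).symm
  rw [hC]
  refine max_le (iSup_le fun s => ?_) (iSup_le fun s => ?_)
  · rw [← ofReal_norm]
    exact ENNReal.ofReal_le_ofReal (hFn _ (hl s))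
  · rw [← ofReal_norm]
    refine ENNReal.ofReal_le_ofReal ?_
    rw [norm_smul, mul_assoc, mul_comm S]
    exact mul_le_mul (hpn _ (hr s)) (hgn s) (norm_nonneg _) (Real.exp_pos _).le

end ComplexInterpolationLower

/-! ### Dyadic decomposition and the lower complex embedding -/

section ComplexInterpolationHolder

variable (X : Type*) [MetricSpace X] [CompactSpace X] {θ ϑ : ℝ≥0}

theorem HolderSpace.exists_lipschitz_series {X : Type*} [MetricSpace X] [CompactSpace X]
    (hϑ₀ : 0 < ϑ) (hϑ : ϑ ≤ 1) (f : HolderSpace X ℂ ϑ) :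
    ∃ u : ℕ → HolderSpace X ℂ 1,
      HasSum (fun n => holderIncl X ℂ 1 (u n)) (holderIncl X ℂ ϑ f) ∧
      (∀ n : ℕ, ‖holderIncl X ℂ 1 (u n)‖ ≤ 21 * ‖f‖ * 2 ^ (n * (-(ϑ : ℝ)))) ∧
      ∀ n : ℕ, ‖u n‖ ≤ 21 * ‖f‖ * 2 ^ (n * (1 - (ϑ : ℝ))) := by
  have ht : ∀ n : ℕ, (0 : ℝ) < 2 ^ (-(n : ℝ)) := fun n => by positivity
  have ht₁ : ∀ n : ℕ, (2 : ℝ) ^ (-(n : ℝ)) ≤ 1 := fun n =>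
    Real.rpow_le_one_of_one_le_of_nonpos one_le_two (by simp)
  choose b hb using fun n => f.exists_lipschitz_approx hϑ (ht n) (ht₁ n)
  set φ := holderIncl X ℂ ϑ f with hφ
  have hpow : ∀ n : ℕ, ((2 : ℝ) ^ (-(n : ℝ))) ^ (ϑ : ℝ) = 2 ^ (n * (-(ϑ : ℝ))) := fun n => by
    rw [← Real.rpow_mul two_pos.le]; congr 1; ring
  have hbX : ∀ n : ℕ, ‖φ - holderIncl X ℂ 1 (b n)‖ ≤ 7 * ‖f‖ * 2 ^ (n * (-(ϑ : ℝ))) := fun n => by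
    have := hb n
    rw [hpow] at this
    have h2 : 0 ≤ (2 : ℝ) ^ (-(n : ℝ)) * ‖b n‖ := by positivity
    linarith
  have hbY : ∀ n : ℕ, ‖b n‖ ≤ 7 * ‖f‖ * 2 ^ (n * (1 - (ϑ : ℝ))) := fun n => by
    have h1 := hb n
    rw [hpow] at h1
    have h2 : (2 : ℝ) ^ (-(n : ℝ)) * ‖b n‖ ≤ 7 * 2 ^ (n * (-(ϑ : ℝ))) * ‖f‖ := by
      linarith [norm_nonneg (φ - holderIncl X ℂ 1 (b n))]
    have h3 := mul_le_mul_of_nonneg_left h2 (show (0 : ℝ) ≤ 2 ^ (n : ℝ) by positivity)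
    rw [← mul_assoc, ← Real.rpow_add two_pos, add_neg_cancel, Real.rpow_zero, one_mul] at h3
    have h4 : (2 : ℝ) ^ (n * (1 - (ϑ : ℝ))) = 2 ^ (n : ℝ) * 2 ^ (n * (-(ϑ : ℝ))) := by
      rw [← Real.rpow_add two_pos]; congr 1; ring
    rw [h4]
    linarith
  have hϑ' : (ϑ : ℝ) ≤ 1 := by exact_mod_cast hϑ
  -- Passing from index `n` to `n + 1` costs a factor `2^ϑ ≤ 2` in `C`, so the differences get `21 =
  -- 2·7 + 7`.
  have hmonoX : ∀ n : ℕ, (2 : ℝ) ^ (n * (-(ϑ : ℝ))) ≤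
      2 * 2 ^ (((n + 1 : ℕ) : ℝ) * (-(ϑ : ℝ))) := fun n => by
    have : (2 : ℝ) * 2 ^ (((n + 1 : ℕ) : ℝ) * (-(ϑ : ℝ))) =
        2 ^ (1 + ((n + 1 : ℕ) : ℝ) * (-(ϑ : ℝ))) := by
      rw [Real.rpow_add two_pos, Real.rpow_one]
    rw [this]
    exact Real.rpow_le_rpow_of_exponent_le one_le_two (by push_cast; linarith)
  have hmonoY : ∀ n : ℕ, (2 : ℝ) ^ (n * (1 - (ϑ : ℝ))) ≤
      2 ^ (((n + 1 : ℕ) : ℝ) * (1 - (ϑ : ℝ))) := fun n =>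
    Real.rpow_le_rpow_of_exponent_le one_le_two (by push_cast; linarith)
  -- Starting from `b 0` itself makes the sum of the first `n + 1` terms exactly `b n`.
  let u : ℕ → HolderSpace X ℂ 1 := fun n => n.casesOn (b 0) fun k => b (k + 1) - b k
  have hpart : ∀ n, ∑ i ∈ Finset.range (n + 1), u i = b n := fun n => by
    rw [Finset.sum_range_succ', Finset.sum_range_sub]
    exact sub_add_cancel _ _
  have huX : ∀ n : ℕ, ‖holderIncl X ℂ 1 (u n)‖ ≤ 21 * ‖f‖ * 2 ^ (n * (-(ϑ : ℝ))) := by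
    rintro (_ | k)
    · have h1 := hbX 0
      have h2 : ‖φ‖ ≤ ‖f‖ := norm_holderIncl_le f
      have h3 : ‖holderIncl X ℂ 1 (b 0)‖ ≤ ‖φ‖ + ‖φ - holderIncl X ℂ 1 (b 0)‖ :=
        norm_le_norm_add_norm_sub _ _
      simp only [Nat.cast_zero, zero_mul, Real.rpow_zero, mul_one] at h1 ⊢
      change ‖holderIncl X ℂ 1 (b 0)‖ ≤ _
      linarith [norm_nonneg f]
    · have e : holderIncl X ℂ 1 (u (k + 1)) =
          (φ - holderIncl X ℂ 1 (b k)) - (φ - holderIncl X ℂ 1 (b (k + 1))) := by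
        rw [sub_sub_sub_cancel_left, ← map_sub]
      have h1 := mul_le_mul_of_nonneg_left (hmonoX k)
        (show 0 ≤ 7 * ‖f‖ by positivity)
      rw [e]
      refine (norm_sub_le _ _).trans ?_
      linarith [hbX k, hbX (k + 1)]
  have huY : ∀ n : ℕ, ‖u n‖ ≤ 21 * ‖f‖ * 2 ^ (n * (1 - (ϑ : ℝ))) := by
    rintro (_ | k)
    · have h1 := hbY 0
      simp only [Nat.cast_zero, zero_mul, Real.rpow_zero, mul_one] at h1 ⊢
      change ‖b 0‖ ≤ _
      linarith [norm_nonneg f]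
    · have h1 := mul_le_mul_of_nonneg_left (hmonoY k) (show 0 ≤ 7 * ‖f‖ by positivity)
      have h2 : 0 ≤ 7 * ‖f‖ * 2 ^ (((k + 1 : ℕ) : ℝ) * (1 - (ϑ : ℝ))) := by positivity
      refine (norm_sub_le (b (k + 1)) (b k)).trans ?_
      linarith [hbY k, hbY (k + 1)]
  refine ⟨u, ?_, huX, huY⟩
  have hdecay : Summable fun n : ℕ => (2 : ℝ) ^ (n * (-(ϑ : ℝ))) := by
    simpa only [mul_neg] using summable_two_rpow_neg_mul (NNReal.coe_pos.2 hϑ₀)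
  rw [(Summable.of_norm_bounded (hdecay.mul_left _) huX).hasSum_iff_tendsto_nat,
    ← tendsto_add_atTop_iff_nat 1]
  simp only [← map_sum, hpart]
  refine tendsto_iff_norm_sub_tendsto_zero.2 (squeeze_zero (fun _ => norm_nonneg _)
    (fun n => (norm_sub_rev _ _).trans_le (hbX n)) ?_)
  simpa using hdecay.tendsto_atTop_zero.const_mul (7 * ‖f‖)

theorem contEmbeds_holder_complexInterpHolderC (hϑ₁ : ϑ ≤ 1) (h : θ < ϑ) :
    ContEmbeds (inclENorm (holderIncl X ℂ ϑ)) (complexInterpHolderC X θ) := by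
  obtain ⟨C, hC⟩ := complexInterpENorm_le_of_hasSum (holderIncl X ℂ 1)
    (NNReal.coe_lt_coe.2 h)
  refine contEmbeds_inclENorm (holderIncl_injective X ℂ ϑ) (C * 21) fun f => ?_
  obtain ⟨u, h1, h2, h3⟩ := f.exists_lipschitz_series (pos_of_gt h) hϑ₁
  refine (hC _ u _ (by positivity) h1 h2 h3).trans_eq ?_
  rw [ENNReal.ofReal_mul (by norm_num), ofReal_norm, ENNReal.coe_mul, mul_assoc]
  simp

theorem ContEmbeds.comp {V W : Type*} {N M : W → ℝ≥0∞} (h : ContEmbeds N M) (e : V → W) :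
    ContEmbeds (fun x => N (e x)) fun x => M (e x) := by
  obtain ⟨C, hC⟩ := h
  exact ⟨C, fun x => hC (e x)⟩

theorem contEmbeds_holder_complexInterpHolderR (hϑ₁ : ϑ ≤ 1) (h : θ < ϑ) :
    ContEmbeds (inclENorm (holderIncl X ℝ ϑ)) (complexInterpHolderR X θ) := by
  have := (contEmbeds_holder_complexInterpHolderC X hϑ₁ h).comp (complexify X)
  simp only [inclENorm_complexify] at this
  exact this

theorem contEmbeds_complexInterpHolderR_holder (hθ : θ ≤ 1) :
    ContEmbeds (complexInterpHolderR X θ) (inclENorm (holderIncl X ℝ θ)) := by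
  have := (contEmbeds_complexInterpHolderC_holder X hθ).comp (complexify X)
  simp only [inclENorm_complexify] at this
  exact this

end ComplexInterpolationHolder

theorem propositionA2 {d : ℕ} (E : Set (EuclideanSpace ℝ (Fin d))) [CompactSpace E] [Nonempty E] :
    -- real interpolation, for real-valued and for complex-valued functions
    (∀ θ : ℝ≥0, 0 < θ → θ < 1 →
      EqualSpaces (realInterpENorm (holderIncl E ℝ 1) θ) (inclENorm (holderIncl E ℝ θ)) ∧
      EqualSpaces (realInterpENorm (holderIncl E ℂ 1) θ) (inclENorm (holderIncl E ℂ θ))) ∧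
    -- complex interpolation, for real-valued and for complex-valued functions
    (∀ θ ϑ : ℝ≥0, 0 < θ → θ < 1 → θ < ϑ → ϑ < 1 →
      (ContEmbeds (inclENorm (holderIncl E ℝ ϑ)) (complexInterpHolderR E θ) ∧
        ContEmbeds (complexInterpHolderR E θ) (inclENorm (holderIncl E ℝ θ))) ∧
      (ContEmbeds (inclENorm (holderIncl E ℂ ϑ)) (complexInterpHolderC E θ) ∧
        ContEmbeds (complexInterpHolderC E θ) (inclENorm (holderIncl E ℂ θ)))) :=
  ⟨fun _ _ hθ => ⟨equalSpaces_realInterp_holder E ℝ hθ.le, equalSpaces_realInterp_holder E ℂ hθ.le⟩,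
    fun _ _ _ hθ h hϑ =>
      ⟨⟨contEmbeds_holder_complexInterpHolderR E hϑ.le h,
        contEmbeds_complexInterpHolderR_holder E hθ.le⟩,
      contEmbeds_holder_complexInterpHolderC E hϑ.le h,
      contEmbeds_complexInterpHolderC_holder E hθ.le⟩⟩

end
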